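/- Let $t\ge 1$ be an integer and let $G$ be a finite simple connected graph of order $n\geq 5t+2$ whose minimum degree satisfies $\delta(G)\geq t$. Write $\lambda(\cdot)$ for the largest eigenvalue of the adjacency matrix of a graph (the adjacency spectral radius), $G_1\cup G_2$ for the disjoint union of two graphs, $tK_1$ for the disjoint union of $t$ copies of the one-vertex graph $K_1$, and $G_1\vee G_2$ for the join, obtained from $G_1\cup G_2$ by adding all edges between $G_1$ and $G_2$. If $$\lambda(G)\geq\lambda\bigl(K_t\vee(K_{n-2t}\cup tK_1)\bigr),$$ then $G$ has a spanning tree with leaf distance at least four, that is, a spanning tree $T$ such that any two different leaves (vertices of degree one) of $T$ are at distance at least four in $T$. -/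

import Mathlib

namespace SimpleGraph

/-- The join `G ∨ H` of two vertex-disjoint graphs: the disjoint union of `G` and `H` together with
all edges between a vertex of `G` and a vertex of `H`. -/
def graphJoin {V W : Type*} (G : SimpleGraph V) (H : SimpleGraph W) : SimpleGraph (V ⊕ W) :=
  (G ⊕g H) ⊔ completeBipartiteGraph V W

/-- The graph `K_t ∨ (K_{n-2t} ∪ t K_1)`. Here `t K_1`, the disjoint union of `t` one-vertex graphs,
is the edgeless graph on `t` vertices. It has `n` vertices as soon as `2 * t ≤ n`. -/
def cliqueJoinCliqueUnionIsolated (n t : ℕ) :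
    SimpleGraph (Fin t ⊕ (Fin (n - 2 * t) ⊕ Fin t)) :=
  graphJoin (completeGraph (Fin t)) (completeGraph (Fin (n - 2 * t)) ⊕g emptyGraph (Fin t))

open Classical in
/-- The adjacency spectral radius of a finite graph: the largest (real) eigenvalue of its adjacency
matrix. -/
noncomputable def adjSpectralRadius {V : Type*} [Fintype V] (G : SimpleGraph V) : ℝ :=
  sSup (spectrum ℝ (G.adjMatrix ℝ))

open Classical in
/-- For a graph with at least one vertex the supremum above is attained: it really is the largest
eigenvalue of the adjacency matrix. -/
theorem isGreatest_adjSpectralRadius {V : Type*} [Fintype V] [Nonempty V] (G : SimpleGraph V) :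
    IsGreatest (spectrum ℝ (G.adjMatrix ℝ)) G.adjSpectralRadius := by
  have hH : (G.adjMatrix ℝ).IsHermitian := by
    rw [Matrix.IsHermitian, Matrix.conjTranspose_eq_transpose_of_trivial,
      SimpleGraph.transpose_adjMatrix]
  have hne : (spectrum ℝ (G.adjMatrix ℝ)).Nonempty := by
    rw [hH.spectrum_real_eq_range_eigenvalues]
    exact Set.range_nonempty _
  have hfin : (spectrum ℝ (G.adjMatrix ℝ)).Finite := Matrix.finite_real_spectrum
  exact ⟨hne.csSup_mem hfin, fun _ hx => le_csSup hfin.bddAbove hx⟩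

/-- A leaf of a tree `T` is a vertex of degree one. -/
def IsLeaf {V : Type*} (T : SimpleGraph V) (v : V) : Prop :=
  (T.neighborSet v).ncard = 1

/-- The leaf distance of a tree `T`: the minimum distance in `T` between two different leaves. -/
noncomputable def leafDistance {V : Type*} (T : SimpleGraph V) : ℕ∞ :=
  ⨅ (u : V) (v : V) (_ : T.IsLeaf u ∧ T.IsLeaf v ∧ u ≠ v), T.edist u v

end SimpleGraph

namespace SimpleGraph

/-! The spanning tree is a Hamiltonian path: its only leaves are its ends, at distance `n - 1 ≥ 6`.
Suppose there is none. Ore's crossing argument in an edge-maximal non-traceable supergraph gives,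
for some `k ≥ t`, disjoint `k`-sets `H` and `L` with degrees at most `k` on `L` and at most `n - 2 -
k` off `H`.

Let `μ > n - t - 1` be a root of the cubic of the three-class quotient of the extremal graph, so `μ`
is one of its eigenvalues. Replacing `t` by `k` in that cubic keeps it nonnegative at `μ`; this uses
`5t + 2 ≤ n`. Hence eigenvector-shaped weights on `H`, `L` and the rest satisfy `A w ≤ μ w` for `G`,
strictly off `H ∪ L`. Connectedness then gives `λ(G) < μ`, contradicting the spectral hypothesis. -/

/-! ### Paths as trees, and their leaf distance -/

theorem pathGraph_isTree (n : ℕ) : (pathGraph (n + 1)).IsTree := by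
  rw [isTree_iff_minimal_connected]
  refine ⟨pathGraph_connected n, fun H hH hle => ?_⟩
  have key : ∀ i j : Fin (n + 1), i.val + 1 = j.val → H.Adj i j := by
    intro i j hij
    by_contra hadj
    -- The edge `ij` is the only way out of the initial segment up to `i`; without it `H` is
    -- disconnected.
    have hclosed : ∀ x y : Fin (n + 1), H.Walk x y → x ≤ i → y ≤ i := by
      intro x y p
      induction p with
      | nil => exact id
      | @cons a b c h p ih =>
        intro ha
        apply ih
        by_contra hb
        have hab := pathGraph_adj.1 (hle h)
        have h1 : a = i := by
          ext; simp only [Fin.le_def] at ha hb; omega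
        have h2 : b = j := by
          ext; simp only [Fin.le_def] at ha hb; omega
        exact hadj (h1 ▸ h2 ▸ h)
    obtain ⟨p⟩ := hH.preconnected i j
    have := hclosed i j p le_rfl
    simp only [Fin.le_def] at this
    omega
  intro i j hij
  rcases pathGraph_adj.1 hij with h | h
  · exact key i j h
  · exact (key j i h).symm

theorem pathGraph_edist_ge {n : ℕ} (i j : Fin n) : ((j.val - i.val : ℕ) : ℕ∞) ≤ (pathGraph n).edist i j := by
  refine le_iInf fun p => ?_
  have : j.val - i.val ≤ p.length := by
    induction p with
    | nil => simp
    | cons h p ih =>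
      have := pathGraph_adj.1 h
      rw [Walk.length_cons]
      omega
  exact_mod_cast this

theorem IsLeaf.eq_zero_or_eq_last {n : ℕ} {i : Fin (n + 1)} (h : (pathGraph (n + 1)).IsLeaf i) :
    i.val = 0 ∨ i.val = n := by
  by_contra! hi
  obtain ⟨a, ha⟩ := Set.ncard_eq_one.1 h
  have h1 : (⟨i.val - 1, by omega⟩ : Fin (n + 1)) ∈ (pathGraph (n + 1)).neighborSet i := by
    rw [mem_neighborSet, pathGraph_adj]; right; simp only; omega
  have h2 : (⟨i.val + 1, by omega⟩ : Fin (n + 1)) ∈ (pathGraph (n + 1)).neighborSet i := by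
    rw [mem_neighborSet, pathGraph_adj]; left; rfl
  rw [ha, Set.mem_singleton_iff] at h1 h2
  have := congrArg Fin.val (h1.trans h2.symm)
  simp only at this
  omega

theorem le_leafDistance_pathGraph (n : ℕ) : (n : ℕ∞) ≤ (pathGraph (n + 1)).leafDistance := by
  refine le_iInf fun i => le_iInf fun j => le_iInf fun ⟨hi, hj, hij⟩ => ?_
  have hi := hi.eq_zero_or_eq_last
  have hj := hj.eq_zero_or_eq_last
  have hij : i.val ≠ j.val := fun h => hij (Fin.ext h)
  rcases hi with hi | hi
  · have : n = j.val - i.val := by omega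
    conv_lhs => rw [this]
    exact pathGraph_edist_ge i j
  · have : n = i.val - j.val := by omega
    conv_lhs => rw [this]
    rw [edist_comm]
    exact pathGraph_edist_ge j i

theorem Hom.edist_le {V W : Type*} {G : SimpleGraph V} {H : SimpleGraph W} (f : G →g H) (u v : V) :
    H.edist (f u) (f v) ≤ G.edist u v := by
  refine le_iInf fun p => ?_
  have := Walk.edist_le (p.map f)
  rwa [Walk.length_map] at this

theorem Iso.isLeaf {V W : Type*} {G : SimpleGraph V} {H : SimpleGraph W} (f : G ≃g H) {v : V}
    (h : G.IsLeaf v) : H.IsLeaf (f v) := by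
  have : H.neighborSet (f v) = f '' G.neighborSet v := by
    ext w
    obtain ⟨w, rfl⟩ := f.surjective w
    rw [mem_neighborSet, f.map_adj_iff, f.injective.mem_set_image, mem_neighborSet]
  rw [IsLeaf, this, Set.ncard_image_of_injective _ f.injective]
  exact h

theorem Iso.leafDistance_le {V W : Type*} {G : SimpleGraph V} {H : SimpleGraph W} (f : G ≃g H) :
    G.leafDistance ≤ H.leafDistance := by
  refine le_iInf fun i => le_iInf fun j => le_iInf fun ⟨hi, hj, hij⟩ => ?_
  refine le_trans ?_ (Hom.edist_le f.symm.toHom i j)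
  exact iInf_le_of_le (f.symm i) (iInf_le_of_le (f.symm j)
    (iInf_le _ ⟨f.symm.isLeaf hi, f.symm.isLeaf hj, fun h => hij (f.symm.injective h)⟩))

/-! ### Hamiltonian paths and Ore's degree argument -/

/-- A graph is traceable if it has a Hamiltonian path, given here as the list of its vertices. -/
def Traceable {V : Type*} (G : SimpleGraph V) : Prop :=
  ∃ l : List V, l.Nodup ∧ (∀ v, v ∈ l) ∧ l.IsChain G.Adj

theorem Traceable.exists_isTree_leafDistance {V : Type*} [Fintype V] [Nonempty V]
    {G : SimpleGraph V} (h : G.Traceable) :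
    ∃ T ≤ G, T.IsTree ∧ ((Fintype.card V - 1 : ℕ) : ℕ∞) ≤ T.leafDistance := by
  classical
  obtain ⟨l, hnd, hmem, hch⟩ := h
  let e := hnd.getEquivOfForallMemList l hmem
  obtain ⟨m, hm⟩ : ∃ m, l.length = m + 1 := by
    have := List.length_pos_of_mem (hmem (Classical.arbitrary V))
    exact ⟨l.length - 1, by omega⟩
  have hcard : Fintype.card V = m + 1 := by
    rw [← hm, ← Fintype.card_congr e, Fintype.card_fin]
  let e' : Fin (m + 1) ≃ V := (finCongr hm.symm).trans e
  have he' : ∀ i : Fin (m + 1), e' i = l[i.val]'(by omega) := fun i => rfl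
  let f := Iso.map e' (pathGraph (m + 1))
  have key : ∀ i j : Fin (m + 1), i.val + 1 = j.val → G.Adj (e' i) (e' j) := by
    intro i j hij
    rw [he', he']
    have := List.isChain_iff_getElem.1 hch i.val (by omega)
    simpa only [hij] using this
  refine ⟨(pathGraph (m + 1)).map e'.toEmbedding, ?_, f.isTree_iff.1 (pathGraph_isTree m), ?_⟩
  · rw [map_le_iff_le_comap]
    intro i j hij
    rcases pathGraph_adj.1 hij with h | h
    · exact key i j h
    · exact (key j i h).symm
  · rw [hcard]
    exact (le_leafDistance_pathGraph m).trans f.leafDistance_le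

theorem traceable_top {V : Type*} [Fintype V] : (⊤ : SimpleGraph V).Traceable :=
  ⟨Finset.univ.toList, Finset.nodup_toList _, by simp,
    (List.Pairwise.imp (fun h => by simpa using h) (Finset.nodup_toList _)).isChain⟩

/-- Reversing the segment with positions in `[p, q)` of a Hamiltonian sequence of vertices gives a
Hamiltonian path as soon as the two new junctions are edges. -/
theorem traceable_of_reverse_segment {V : Type*} {G : SimpleGraph V} {l : List V} (hnd : l.Nodup)
    (hmem : ∀ v, v ∈ l) {p q : ℕ} (hpq : p < q) (hq : q ≤ l.length)
    (hadj : ∀ j (h : j + 1 < l.length), j + 1 ≠ p → j + 1 ≠ q → G.Adj l[j] l[j + 1])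
    (h1 : 0 < p → G.Adj l[p - 1] l[q - 1]) (h2 : ∀ h : q < l.length, G.Adj l[p] l[q]) :
    G.Traceable := by
  have hperm : (l.take p ++ (((l.drop p).take (q - p)).reverse ++ l.drop q)).Perm l := by
    have h3 : l = l.take p ++ ((l.drop p).take (q - p) ++ l.drop q) := by
      have h4 : l.drop q = (l.drop p).drop (q - p) := by
        rw [List.drop_drop]; congr 1; omega
      rw [h4, List.take_append_drop, List.take_append_drop]
    conv_rhs => rw [h3]
    exact ((List.reverse_perm _).append_right _).append_left _
  refine ⟨_, hperm.nodup_iff.2 hnd, fun v => hperm.mem_iff.2 (hmem v), ?_⟩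
  rw [List.isChain_append, List.isChain_append, List.isChain_reverse]
  refine ⟨?_, ⟨?_, ?_, ?_⟩, ?_⟩
  · rw [List.isChain_iff_getElem]
    intro j hj
    rw [List.length_take] at hj
    simp only [List.getElem_take]
    exact hadj j (by omega) (by omega) (by omega)
  · rw [List.isChain_iff_getElem]
    intro j hj
    rw [List.length_take, List.length_drop] at hj
    simp only [List.getElem_take, List.getElem_drop]
    exact (hadj (p + j) (by omega) (by omega) (by omega)).symm
  · rw [List.isChain_iff_getElem]
    intro j hj
    rw [List.length_drop] at hj
    simp only [List.getElem_drop]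
    exact hadj (q + j) (by omega) (by omega) (by omega)
  · intro x hx y hy
    have hqn : q < l.length := by
      by_contra h
      rw [List.drop_eq_nil_of_le (by omega)] at hy
      simp at hy
    rw [Option.mem_def, List.getLast?_reverse, List.head?_take, if_neg (by omega),
      List.head?_drop, List.getElem?_eq_getElem (by omega), Option.some_inj] at hx
    rw [Option.mem_def, List.head?_drop, List.getElem?_eq_getElem hqn, Option.some_inj] at hy
    exact hx ▸ hy ▸ h2 hqn
  · intro x hx y hy
    have hp : 0 < p := by
      by_contra h
      obtain rfl : p = 0 := by omega
      simp at hx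
    have hlen : ((l.drop p).take (q - p)).length = q - p := by
      rw [List.length_take, List.length_drop]; omega
    rw [Option.mem_def, List.getLast?_eq_getElem?, List.length_take, min_eq_left (by omega),
      List.getElem?_take_of_lt (by omega), List.getElem?_eq_getElem (by omega),
      Option.some_inj] at hx
    rw [Option.mem_def, List.head?_append, List.head?_reverse, List.getLast?_eq_getElem?, hlen,
      List.getElem?_take_of_lt (by omega), List.getElem?_drop,
      List.getElem?_eq_getElem (by omega), Option.some_or, Option.some_inj] at hy
    have h3 : p + (q - p - 1) = q - 1 := by omega
    simp only [h3] at hy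
    exact hx ▸ hy ▸ h1 hp

open Classical in
/-- Ore's crossing argument: if `G` is not traceable but becomes so on adding the edge `uv`, then
the degrees of `u` and `v` add up to at most `|V| - 2`. -/
theorem degree_add_degree_le_of_traceable_sup_edge {V : Type*} [Fintype V] {G : SimpleGraph V}
    (hG : ¬ G.Traceable) {u v : V} (huv : ¬ G.Adj u v) (ht : (G ⊔ edge u v).Traceable) :
    G.degree u + G.degree v + 2 ≤ Fintype.card V := by
  obtain ⟨l, hnd, hmem, hch⟩ := ht
  rw [List.isChain_iff_getElem] at hch
  have hlen : l.length = Fintype.card V := by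
    rw [← List.toFinset_card_of_nodup hnd, ← Finset.card_univ]
    congr 1
    ext x
    simp [hmem]
  obtain ⟨i, hi, hadj⟩ : ∃ i, ∃ h : i + 1 < l.length, ¬ G.Adj l[i] l[i + 1] := by
    by_contra! h
    exact hG ⟨l, hnd, hmem, List.isChain_iff_getElem.2 h⟩
  wlog hor : l[i] = u ∧ l[i + 1] = v generalizing u v
  · have h := hch i hi
    rw [sup_adj, edge_adj] at h
    rw [add_comm (G.degree u)]
    refine this (fun h => huv h.symm) (by rwa [edge_comm]) ?_
    tauto
  obtain ⟨hu, hv⟩ := hor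
  have hadj' : ∀ j (h : j + 1 < l.length), j ≠ i → G.Adj l[j] l[j + 1] := by
    intro j hj hji
    have h := hch j hj
    rw [sup_adj, edge_adj, ← hu, ← hv] at h
    simp only [hnd.getElem_inj_iff] at h
    rcases h with h | h
    · exact h
    · omega
  -- Reversing the stretch between the missing edge at `i` and the edge at `j` replaces both by `u
  -- l[j]` and `v l[j + 1]`.
  have hcross : ∀ j (h : j + 1 < l.length), G.Adj u l[j] → ¬ G.Adj v l[j + 1] := by
    intro j hj h1 h2
    rcases lt_trichotomy j i with hji | rfl | hji
    · refine hG (traceable_of_reverse_segment hnd hmem (p := j + 1) (q := i + 1) (by omega)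
        (by omega) (fun k hk _ _ => hadj' k hk (by omega)) (fun _ => ?_) (fun _ => ?_))
      · simpa [hu] using h1.symm
      · simpa [hv] using h2.symm
    · exact G.loopless.irrefl u (by simp [hu] at h1)
    · refine hG (traceable_of_reverse_segment hnd hmem (p := i + 1) (q := j + 1) (by omega)
        (by omega) (fun k hk _ _ => hadj' k hk (by omega)) (fun _ => ?_) (fun _ => ?_))
      · simpa [hu] using h1
      · simpa [hv] using h2
  have hlast : ¬ G.Adj u (l[l.length - 1]) := by
    intro h
    refine hG (traceable_of_reverse_segment hnd hmem (p := i + 1) (q := l.length) (by omega)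
        (by omega) (fun k hk _ _ => hadj' k hk (by omega)) (fun _ => ?_) (fun _ => ?_))
    · simpa [hu] using h
    · omega
  have hfirst : ¬ G.Adj v l[0] := by
    intro h
    refine hG (traceable_of_reverse_segment hnd hmem (p := 0) (q := i + 1) (by omega)
        (by omega) (fun k hk _ _ => hadj' k hk (by omega)) (fun _ => ?_) (fun _ => ?_))
    · omega
    · simpa [hv] using h.symm
  have hidx : ∀ w, ∃ k, ∃ h : k < l.length, l[k] = w := fun w => List.getElem_of_mem (hmem w)
  choose f hf hlf using hidx
  have hfinj : Function.Injective f := fun a b hab => by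
    rw [← hlf a, ← hlf b]
    simp only [hab]
  -- The successors of neighbours of `u` and the neighbours of `v` occupy disjoint sets of
  -- positions, both missing `0` and `i + 1`: hence the 2 in the bound.
  have hsub : (G.neighborFinset u).image (fun w => f w + 1) ∪ (G.neighborFinset v).image f
      ⊆ ((Finset.range l.length).erase 0).erase (i + 1) := by
    intro k hk
    simp only [Finset.mem_union, Finset.mem_image, mem_neighborFinset] at hk
    simp only [Finset.mem_erase, Finset.mem_range]
    rcases hk with ⟨w, hw, rfl⟩ | ⟨w, hw, rfl⟩
    · have h1 : f w ≠ i := fun h => by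
        have := hlf w
        simp only [h, hu] at this
        exact hw.ne this
      have h2 : f w ≠ l.length - 1 := fun h => by
        have := hlf w
        simp only [h] at this
        exact hlast (this ▸ hw)
      have := hf w
      omega
    · have h1 : f w ≠ i + 1 := fun h => by
        have := hlf w
        simp only [h, hv] at this
        exact hw.ne this
      have h2 : f w ≠ 0 := fun h => by
        have := hlf w
        simp only [h] at this
        exact hfirst (this ▸ hw)
      exact ⟨h1, h2, hf w⟩
  have hdisj : Disjoint ((G.neighborFinset u).image (fun w => f w + 1))
      ((G.neighborFinset v).image f) := by
    rw [Finset.disjoint_left]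
    intro k hk hk'
    simp only [Finset.mem_image, mem_neighborFinset] at hk hk'
    obtain ⟨w, hw, rfl⟩ := hk
    obtain ⟨x, hx, hxw⟩ := hk'
    have hlx := hlf x
    simp only [hxw] at hlx
    exact hcross (f w) (hxw ▸ hf x) ((hlf w).symm ▸ hw) (hlx.symm ▸ hx)
  have hle := Finset.card_le_card hsub
  rw [Finset.card_union_of_disjoint hdisj,
    Finset.card_image_of_injective _ (fun a b h => hfinj (Nat.succ_injective h)),
    Finset.card_image_of_injective _ hfinj, card_neighborFinset_eq_degree,
    card_neighborFinset_eq_degree, Finset.card_erase_of_mem (by simp; omega),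
    Finset.card_erase_of_mem (by simp; omega), Finset.card_range] at hle
  omega

open Classical in
/-- The degree structure of non-traceable graphs: such a graph lies in a graph in which, for some
`k ≥ δ` with `2 * k + 2 ≤ |V|`, there are disjoint `k`-sets `L` and `H` such that vertices in `L`
have degree at most `k`, and vertices outside `H` have degree at most `|V| - 2 - k`. -/
theorem exists_degree_bounds_of_not_traceable {V : Type*} [Fintype V] {G : SimpleGraph V}
    (hG : ¬ G.Traceable) {t : ℕ} (ht : ∀ v, t ≤ G.degree v) :
    ∃ (C : SimpleGraph V) (k : ℕ) (H L : Finset V), G ≤ C ∧ t ≤ k ∧ 2 * k + 2 ≤ Fintype.card V ∧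
      Disjoint H L ∧ H.card = k ∧ L.card = k ∧ (∀ v ∈ L, C.degree v ≤ k) ∧
      ∀ v ∉ H, C.degree v + k + 2 ≤ Fintype.card V := by
  obtain ⟨C, hGC, hC⟩ := Finite.exists_le_maximal (p := fun H : SimpleGraph V => ¬ H.Traceable) hG
  have hsum : ∀ u v, u ≠ v → ¬ C.Adj u v → C.degree u + C.degree v + 2 ≤ Fintype.card V := by
    intro u v hne huv
    refine degree_add_degree_le_of_traceable_sup_edge hC.prop huv ?_
    by_contra h
    exact (lt_sup_edge _ _ _ hne huv).not_ge (hC.le_of_ge h le_sup_left)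
  let S : Finset (V × V) := Finset.univ.filter fun p => p.1 ≠ p.2 ∧ ¬ C.Adj p.1 p.2
  have hS : S.Nonempty := by
    by_contra hS
    refine hC.prop ?_
    have : C = ⊤ := by
      ext u v
      simp only [Finset.not_nonempty_iff_eq_empty, S, Finset.filter_eq_empty_iff] at hS
      have := @hS (u, v) (Finset.mem_univ _)
      simp only [top_adj]
      refine ⟨fun h => h.ne, fun h => ?_⟩
      tauto
    rw [this]
    exact traceable_top
  -- For a nonadjacent pair of maximal degree sum, every non-neighbour of `v` has degree at most
  -- that of `u`; `L` is chosen among these.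
  obtain ⟨⟨u, v⟩, huvS, hmaxS⟩ := S.exists_max_image (fun p => C.degree p.1 + C.degree p.2) hS
  obtain ⟨hne, huv⟩ : u ≠ v ∧ ¬ C.Adj u v := by simpa [S] using huvS
  have hmax : ∀ x y, x ≠ y → ¬ C.Adj x y → C.degree x + C.degree y ≤ C.degree u + C.degree v :=
    fun x y h1 h2 => hmaxS (x, y) (by simp [S, h1, h2])
  clear huvS hmaxS
  wlog hle : C.degree u ≤ C.degree v generalizing u v
  · exact this v u hne.symm (fun h => huv h.symm)
      (fun x y h1 h2 => by rw [add_comm (C.degree v)]; exact hmax x y h1 h2) (by omega)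
  have huvsum := hsum u v hne huv
  set k := C.degree u with hk
  have hcompl : ∀ x, (Finset.univ.filter fun w => w ≠ x ∧ ¬ C.Adj x w).card + C.degree x + 1
      = Fintype.card V := by
    intro x
    have h1 : (Finset.univ.filter fun w => w ≠ x ∧ ¬ C.Adj x w) = (insert x (C.neighborFinset x))ᶜ := by
      ext w; simp
    have h2 := Finset.card_add_card_compl (insert x (C.neighborFinset x))
    rw [Finset.card_insert_of_notMem (by simp), card_neighborFinset_eq_degree] at h2
    rw [h1]; omega
  obtain ⟨L, hLsub, hL⟩ : ∃ L ⊆ Finset.univ.filter (fun w => w ≠ v ∧ ¬ C.Adj v w), L.card = k :=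
    Finset.exists_subset_card_eq (by have := hcompl v; omega)
  have hLdeg : ∀ w ∈ L, C.degree w ≤ k := by
    intro w hw
    have hw := hLsub hw
    simp only [Finset.mem_filter, Finset.mem_univ, true_and] at hw
    have := hmax v w hw.1.symm hw.2
    omega
  -- The vertices of too large degree are all adjacent to `u`, so there are at most `k`; `H` pads
  -- them to exactly `k` while avoiding `L`.
  let K := Finset.univ.filter fun w => ¬ (C.degree w + k + 2 ≤ Fintype.card V)
  have hKN : K ⊆ C.neighborFinset u := by
    intro w hw
    simp only [K, Finset.mem_filter, Finset.mem_univ, true_and] at hw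
    rw [mem_neighborFinset]
    by_contra hn
    rcases eq_or_ne u w with rfl | h
    · omega
    · have := hsum u w h hn
      omega
  have hKL : K ⊆ Lᶜ := by
    intro w hw
    simp only [K, Finset.mem_filter, Finset.mem_univ, true_and] at hw
    rw [Finset.mem_compl]
    intro h
    have := hLdeg w h
    omega
  obtain ⟨H, hKH, hHL, hH⟩ := Finset.exists_subsuperset_card_eq hKL (n := k)
    (by have := Finset.card_le_card hKN; rwa [card_neighborFinset_eq_degree] at this)
    (by rw [Finset.card_compl]; omega)
  refine ⟨C, k, H, L, hGC, ?_, by omega, ?_, hH, hL, hLdeg, ?_⟩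
  · exact (ht u).trans (degree_le_of_le hGC)
  · exact Finset.disjoint_left.2 fun w h1 h2 => by simpa [h2] using hHL h1
  · intro w hw
    by_contra h
    exact hw (hKH (by simpa [K] using h))

/-! ### Eigenvalues and strict supersolutions -/

open Classical in
theorem mem_spectrum_adjMatrix_iff {V : Type*} [Fintype V] {G : SimpleGraph V} {μ : ℝ} :
    μ ∈ spectrum ℝ (G.adjMatrix ℝ) ↔
      ∃ u : V → ℝ, u ≠ 0 ∧ ∀ v, ∑ x ∈ G.neighborFinset v, u x = μ * u v := by
  rw [spectrum.mem_iff, Matrix.isUnit_iff_isUnit_det, isUnit_iff_ne_zero, not_not,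
    ← Matrix.exists_mulVec_eq_zero_iff]
  refine exists_congr fun u => and_congr_right fun _ => ?_
  rw [Matrix.sub_mulVec, sub_eq_zero, funext_iff]
  refine forall_congr' fun v => ?_
  rw [adjMatrix_mulVec_apply, Algebra.algebraMap_eq_smul_one, Matrix.smul_mulVec, Matrix.one_mulVec,
    Pi.smul_apply, smul_eq_mul, eq_comm]

open Classical in
/-- A positive vector `w` with `A w ≤ μ w`, where the inequality is strict somewhere, bounds the
spectral radius of a connected graph strictly by `μ`. -/
theorem Connected.adjSpectralRadius_lt {V : Type*} [Fintype V] {G : SimpleGraph V}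
    (hG : G.Connected) {w : V → ℝ} {μ : ℝ} (hw : ∀ v, 0 < w v)
    (hle : ∀ v, ∑ x ∈ G.neighborFinset v, w x ≤ μ * w v) {v₀ : V}
    (hlt : ∑ x ∈ G.neighborFinset v₀, w x < μ * w v₀) : G.adjSpectralRadius < μ := by
  by_contra! hρ
  have := hG.nonempty
  set ρ := G.adjSpectralRadius
  obtain ⟨u, hu0, hu⟩ := mem_spectrum_adjMatrix_iff.1 G.isGreatest_adjSpectralRadius.1
  have hsub : ∀ v, 0 ≤ (∑ x ∈ G.neighborFinset v, |u x|) - ρ * |u v| := by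
    intro v
    have h1 : ρ * |u v| ≤ |ρ * u v| := by
      rw [abs_mul]
      exact mul_le_mul_of_nonneg_right (le_abs_self _) (abs_nonneg _)
    have h2 := Finset.abs_sum_le_sum_abs u (G.neighborFinset v)
    rw [hu v] at h2
    linarith
  have hsymm : ∑ v, w v * ∑ x ∈ G.neighborFinset v, |u x|
      = ∑ v, |u v| * ∑ x ∈ G.neighborFinset v, w x := by
    simp only [neighborFinset_eq_filter, Finset.sum_filter, Finset.mul_sum]
    rw [Finset.sum_comm]
    refine Finset.sum_congr rfl fun v _ => Finset.sum_congr rfl fun x _ => ?_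
    simp only [G.adj_comm x v]
    split_ifs <;> ring
  have hpos1 : ∀ v, 0 ≤ w v * ((∑ x ∈ G.neighborFinset v, |u x|) - ρ * |u v|) := fun v =>
    mul_nonneg (hw v).le (hsub v)
  have hpos2 : ∀ v, 0 ≤ |u v| * (ρ * w v - ∑ x ∈ G.neighborFinset v, w x) := fun v =>
    mul_nonneg (abs_nonneg _)
      (by have := hle v; have := mul_le_mul_of_nonneg_right hρ (hw v).le; linarith)
  -- Pairing `|u|` with `w` through the symmetric matrix makes two nonnegative sums cancel, so all
  -- their terms vanish. Strictness at `v₀` kills `u v₀`, and the zero spreads along edges.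
  have hsum : ∑ v, w v * ((∑ x ∈ G.neighborFinset v, |u x|) - ρ * |u v|)
      + ∑ v, |u v| * (ρ * w v - ∑ x ∈ G.neighborFinset v, w x) = 0 := by
    simp only [mul_sub, Finset.sum_sub_distrib]
    rw [hsymm]
    have : ∑ v, w v * (ρ * |u v|) = ∑ v, |u v| * (ρ * w v) :=
      Finset.sum_congr rfl fun v _ => by ring
    rw [this]; ring
  have hs1 := Finset.sum_nonneg fun v (_ : v ∈ Finset.univ) => hpos1 v
  have hs2 := Finset.sum_nonneg fun v (_ : v ∈ Finset.univ) => hpos2 v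
  have hz1 := (Finset.sum_eq_zero_iff_of_nonneg fun v _ => hpos1 v).1 (by linarith)
  have hz2 := (Finset.sum_eq_zero_iff_of_nonneg fun v _ => hpos2 v).1 (by linarith)
  have hv₀ : u v₀ = 0 := by
    rcases mul_eq_zero.1 (hz2 v₀ (Finset.mem_univ _)) with h | h
    · exact abs_eq_zero.1 h
    · have := mul_le_mul_of_nonneg_right hρ (hw v₀).le
      linarith
  have hstep : ∀ v x, G.Adj v x → u v = 0 → u x = 0 := by
    intro v x hvx hv
    have h1 := (mul_eq_zero.1 (hz1 v (Finset.mem_univ _))).resolve_left (hw v).ne'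
    rw [hv, abs_zero, mul_zero, sub_zero,
      Finset.sum_eq_zero_iff_of_nonneg fun _ _ => abs_nonneg _] at h1
    exact abs_eq_zero.1 (h1 x (by simpa using hvx))
  refine hu0 (funext fun x => ?_)
  obtain ⟨p⟩ := hG.preconnected v₀ x
  clear hlt
  induction p with
  | nil => exact hv₀
  | cons h p ih => exact ih (hstep _ _ h hv₀)

theorem sum_neighborFinset {V M : Type*} [Fintype V] [AddCommMonoid M] (G : SimpleGraph V) (v : V)
    [Fintype (G.neighborSet v)] [DecidablePred (G.Adj v)] (u : V → M) :
    ∑ x ∈ G.neighborFinset v, u x = ∑ x, if G.Adj v x then u x else 0 := by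
  rw [← Finset.sum_filter]
  exact Finset.sum_congr (by ext; simp) fun _ _ => rfl

/-! ### The extremal graph and its cubic -/

/-- The weights, constant on the three classes, solve the eigenvalue equation identically on
`K_{n-2t}` and `tK_1`; on `K_t` it is the cubic. -/
theorem le_adjSpectralRadius_cliqueJoinCliqueUnionIsolated {n t : ℕ} (ht : 1 ≤ t) (hn : 2 * t ≤ n)
    {μ : ℝ} (hμ : μ ≠ 0) (hμ' : μ - n + 2 * t + 1 ≠ 0)
    (hroot : μ * (μ + 1) * (μ - (n - t - 1)) - t ^ 2 * (μ - n + 2 * t + 1) = 0) :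
    μ ≤ (cliqueJoinCliqueUnionIsolated n t).adjSpectralRadius := by
  classical
  have : Nonempty (Fin t) := ⟨⟨0, ht⟩⟩
  refine (isGreatest_adjSpectralRadius _).2 (mem_spectrum_adjMatrix_iff.2
    ⟨Sum.elim (fun _ => μ * (μ - n + 2 * t + 1))
      (Sum.elim (fun _ => t * μ) fun _ => t * (μ - n + 2 * t + 1)), ?_, ?_⟩)
  · intro h
    have := congrFun h (Sum.inl ⟨0, ht⟩)
    simp [hμ, hμ'] at this
  · have hcl : ∀ (m : ℕ) (i : Fin m) (a : ℝ), ∑ x : Fin m, (if i = x then 0 else a) = (m - 1) * a := by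
      intro m i a
      have : ∀ x : Fin m, (if i = x then 0 else a) = a - if i = x then a else 0 := by
        intro x; split_ifs <;> ring
      simp only [this, Finset.sum_sub_distrib, Finset.sum_ite_eq, Finset.mem_univ, if_true,
        Finset.sum_const, Finset.card_univ, Fintype.card_fin, nsmul_eq_mul]
      ring
    rintro (i | i | i) <;>
    rw [sum_neighborFinset] <;>
    simp only [Fintype.sum_sum_type, cliqueJoinCliqueUnionIsolated, graphJoin] <;>
    simp [hcl, Nat.cast_sub hn]
    · linear_combination -hroot
    · ring
    · ring

/-- The cubic equals `-t ^ 3` at `n - t - 1` and is nonnegative at `n`. -/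
theorem exists_root_cliqueJoinCliqueUnionIsolated {n t : ℝ} (ht : 1 ≤ t) (hn : 2 * t + 1 ≤ n) :
    ∃ μ, n - t - 1 < μ ∧ μ * (μ + 1) * (μ - (n - t - 1)) - t ^ 2 * (μ - n + 2 * t + 1) = 0 := by
  have hcont : ContinuousOn
      (fun μ : ℝ => μ * (μ + 1) * (μ - (n - t - 1)) - t ^ 2 * (μ - n + 2 * t + 1))
      (Set.Icc (n - t - 1) n) := by fun_prop
  obtain ⟨μ, hμ, h⟩ := intermediate_value_Icc (by linarith) hcont
    (show (0 : ℝ) ∈ Set.Icc _ _ by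
      constructor
      · ring_nf
        nlinarith [pow_pos (show (0 : ℝ) < t by linarith) 3]
      · have h1 : n * (n + 1) * (n - (n - t - 1)) - t ^ 2 * (n - n + 2 * t + 1)
            = n * (n + 1) * (t + 1) - t ^ 2 * (2 * t + 1) := by ring
        simp only [h1]
        have h2 : t ^ 2 ≤ n * (n + 1) := by nlinarith
        have h3 : (t ^ 2) * (2 * t + 1) ≤ n * (n + 1) * (t + 1) := by
          have h4 : 2 * t ^ 2 ≤ n * (n + 1) := by nlinarith
          nlinarith
        linarith)
  refine ⟨μ, lt_of_le_of_ne hμ.1 ?_, h⟩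
  rintro rfl
  simp only at h
  ring_nf at h
  nlinarith [pow_pos (show (0 : ℝ) < t by linarith) 3]

/-- The cubic for `k` minus that for `t` is `k - t` times the expression in `hg`. -/
theorem cliqueJoinCliqueUnionIsolated_poly_nonneg {n t k μ : ℝ} (ht : 1 ≤ t) (htk : t ≤ k)
    (hk : 2 * k ≤ n) (hn : 5 * t + 2 ≤ n) (hμ : n - t - 1 < μ)
    (hroot : μ * (μ + 1) * (μ - (n - t - 1)) - t ^ 2 * (μ - n + 2 * t + 1) = 0) :
    0 ≤ μ * (μ + 1) * (μ - (n - k - 1)) - k ^ 2 * (μ - n + 2 * k + 1) := by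
  have hg : 0 ≤ μ * (μ + 1) - (μ - n + 1) * (k + t) - 2 * (k ^ 2 + k * t + t ^ 2) := by
    -- This product is the change of the expression from `n - t - 1` to `μ`; its value at `n - t -
    -- 1` is the sum of the next two products and `t`.
    have h1 : 0 ≤ (μ - (n - t - 1)) * (μ + (n - t - 1) + 1 - (k + t)) :=
      mul_nonneg (by linarith) (by linarith)
    have h2 : 0 ≤ (n / 2) * (n - 5 * t - 2) := mul_nonneg (by linarith) (by linarith)
    have h3 : 0 ≤ (n / 2 - k) * (2 * (n / 2 + k) + t) := mul_nonneg (by linarith) (by linarith)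
    nlinarith
  nlinarith [mul_nonneg (sub_nonneg.2 htk) hg]

/-! ### Comparison and conclusion -/

open Classical in
/-- The weight vector of the extremal graph is a strict supersolution for every graph obeying the
degree bounds of a non-traceable graph. -/
theorem adjSpectralRadius_lt_of_degree_bounds {V : Type*} [Fintype V] {G C : SimpleGraph V}
    (hG : G.Connected) (hGC : G ≤ C) {n k : ℕ} (hcard : Fintype.card V = n) (hk : 1 ≤ k)
    (hkn : 2 * k + 2 ≤ n) {H L : Finset V} (hHL : Disjoint H L) (hH : H.card = k) (hL : L.card = k)
    (hLdeg : ∀ v ∈ L, C.degree v ≤ k) (hdeg : ∀ v ∉ H, C.degree v + k + 2 ≤ n)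
    {μ : ℝ} (hμ : n - k - 1 ≤ μ)
    (hpoly : 0 ≤ μ * (μ + 1) * (μ - (n - k - 1)) - k ^ 2 * (μ - n + 2 * k + 1)) :
    G.adjSpectralRadius < μ := by
  have hk' : (1 : ℝ) ≤ k := by exact_mod_cast hk
  have hkn' : 2 * (k : ℝ) + 2 ≤ n := by exact_mod_cast hkn
  have hμ0 : 0 < μ := by linarith
  set d : ℝ := μ - n + 2 * k + 1 with hd
  have hdk : (k : ℝ) ≤ d := by linarith
  have hdμ : d ≤ μ := by linarith
  -- The eigenvector shape of the extremal graph with `k` for `t`: `a` on `H`, `c` on `L`, `b`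
  -- elsewhere.
  set a : ℝ := μ * d
  set b : ℝ := k * μ
  set c : ℝ := k * d
  have hc : 0 < c := mul_pos (by linarith) (by linarith)
  have hcb : c ≤ b := mul_le_mul_of_nonneg_left hdμ (by linarith)
  have hba : b ≤ a := by
    have := mul_le_mul_of_nonneg_left hdk hμ0.le
    simp only [a, b]; linarith
  let w : V → ℝ := fun v => if v ∈ H then a else if v ∈ L then c else b
  have hw : ∀ v, 0 < w v := by
    intro v
    simp only [w]
    split_ifs <;> linarith
  have hwa : ∀ v, w v ≤ a := by
    intro v
    simp only [w]
    split_ifs <;> linarith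
  have hmono : ∀ v, ∑ x ∈ G.neighborFinset v, w x ≤ ∑ x ∈ C.neighborFinset v, w x := fun v =>
    Finset.sum_le_sum_of_subset_of_nonneg
      (fun x hx => by simpa using hGC (by simpa using hx)) fun x _ _ => (hw x).le
  have hsumH : ∑ x, (if x ∈ H then a - b else 0) = k * (a - b) := by
    rw [Finset.sum_ite_mem, Finset.univ_inter, Finset.sum_const, hH, nsmul_eq_mul]
  have hsumL : ∑ x, (if x ∈ L then b - c else 0) = k * (b - c) := by
    rw [Finset.sum_ite_mem, Finset.univ_inter, Finset.sum_const, hL, nsmul_eq_mul]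
  have htotal : ∑ x, w x = k * a + (n - 2 * k) * b + k * c := by
    have : ∀ x, w x = b + (if x ∈ H then a - b else 0) - (if x ∈ L then b - c else 0) := by
      intro x
      simp only [w]
      by_cases h1 : x ∈ H
      · simp [h1, Finset.disjoint_left.1 hHL h1]
      · by_cases h2 : x ∈ L <;> simp [h1, h2]
    simp only [this, Finset.sum_sub_distrib, Finset.sum_add_distrib, hsumH, hsumL,
      Finset.sum_const, Finset.card_univ, hcard, nsmul_eq_mul]
    ring
  have hbH : ∀ v ∈ H, ∑ x ∈ C.neighborFinset v, w x ≤ μ * w v := by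
    intro v hv
    have h1 : ∑ x ∈ C.neighborFinset v, w x ≤ ∑ x ∈ Finset.univ.erase v, w x :=
      Finset.sum_le_sum_of_subset_of_nonneg
        (fun x hx => by
          rw [mem_neighborFinset] at hx
          simpa using hx.ne') fun x _ _ => (hw x).le
    have h2 := Finset.add_sum_erase _ w (Finset.mem_univ v)
    have h3 : w v = a := by simp [w, hv]
    rw [htotal, h3] at h2
    rw [h3]
    have h4 : μ * a - ((k - 1) * a + (n - 2 * k) * b + k * c)
        = μ * (μ + 1) * (μ - (n - k - 1)) - k ^ 2 * d := by
      simp only [a, b, c, hd]; ring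
    linarith
  have hbL : ∀ v ∈ L, ∑ x ∈ C.neighborFinset v, w x ≤ μ * w v := by
    intro v hv
    have h1 : ∑ x ∈ C.neighborFinset v, w x ≤ C.degree v * a := by
      rw [← nsmul_eq_mul, ← card_neighborFinset_eq_degree]
      exact Finset.sum_le_card_nsmul _ _ _ fun x _ => hwa x
    have h2 : (C.degree v : ℝ) ≤ k := by exact_mod_cast hLdeg v hv
    have h3 : w v = c := by simp [w, hv, Finset.disjoint_right.1 hHL hv]
    have h4 := mul_le_mul_of_nonneg_right h2 (show 0 ≤ a by linarith)
    have h5 : μ * c = k * a := by simp only [a, c]; ring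
    rw [h3, h5]
    linarith
  have hbM : ∀ v, v ∉ H → v ∉ L → ∑ x ∈ C.neighborFinset v, w x < μ * w v := by
    intro v hvH hvL
    have h1 : ∑ x ∈ C.neighborFinset v, w x ≤ C.degree v * b + k * (a - b) := by
      calc ∑ x ∈ C.neighborFinset v, w x
          ≤ ∑ x ∈ C.neighborFinset v, (b + if x ∈ H then a - b else 0) := by
            refine Finset.sum_le_sum fun x _ => ?_
            simp only [w]
            split_ifs <;> linarith
        _ = C.degree v * b + ∑ x ∈ C.neighborFinset v, (if x ∈ H then a - b else 0) := by
            rw [Finset.sum_add_distrib, Finset.sum_const, card_neighborFinset_eq_degree,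
              nsmul_eq_mul]
        _ ≤ C.degree v * b + k * (a - b) := by
            rw [← hsumH]
            refine (add_le_add_iff_left _).2 (Finset.sum_le_sum_of_subset_of_nonneg
              (Finset.subset_univ _) fun x _ _ => ?_)
            split_ifs <;> linarith
    have h2 : (C.degree v : ℝ) + k + 2 ≤ n := by exact_mod_cast hdeg v hvH
    have h3 : w v = b := by simp [w, hvH, hvL]
    have h4 := mul_le_mul_of_nonneg_right (show (C.degree v : ℝ) ≤ n - k - 2 by linarith)
      (show 0 ≤ b by linarith)
    -- This identity accounts for `n - k - 1` neighbours, while the degree is at most `n - k - 2`: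
    -- the slack is at least `b > 0`.
    have h5 : μ * b = k * a + (n - 2 * k - 1) * b := by simp only [a, b, hd]; ring
    rw [h3, h5]
    linarith
  obtain ⟨v₀, hv₀⟩ : ∃ v, v ∉ H ∪ L := by
    by_contra! h
    have h1 := Finset.card_le_card (show (Finset.univ : Finset V) ⊆ H ∪ L from fun v _ => h v)
    rw [Finset.card_union_of_disjoint hHL, Finset.card_univ] at h1
    omega
  rw [Finset.mem_union, not_or] at hv₀
  refine hG.adjSpectralRadius_lt hw (fun v => ?_) ((hmono v₀).trans_lt (hbM v₀ hv₀.1 hv₀.2))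
  refine (hmono v).trans ?_
  by_cases h1 : v ∈ H
  · exact hbH v h1
  · by_cases h2 : v ∈ L
    · exact hbL v h2
    · exact (hbM v h1 h2).le

/-- A connected graph of order `n ≥ 5t + 2` and minimum degree at least `t` whose spectral radius is
at least that of `K_t ∨ (K_{n-2t} ∪ tK_1)` has a Hamiltonian path. -/
theorem Connected.traceable_of_le_adjSpectralRadius {V : Type*} [Fintype V] {G : SimpleGraph V}
    [DecidableRel G.Adj] {n t : ℕ} (hcard : Fintype.card V = n) (ht : 1 ≤ t) (hn : 5 * t + 2 ≤ n)
    (hconn : G.Connected) (hδ : t ≤ G.minDegree)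
    (hspec : (cliqueJoinCliqueUnionIsolated n t).adjSpectralRadius ≤ G.adjSpectralRadius) :
    G.Traceable := by
  classical
  by_contra hG
  obtain ⟨C, k, H, L, hGC, htk, hkn, hHL, hH, hL, hLdeg, hdeg⟩ :=
    exists_degree_bounds_of_not_traceable hG (t := t) fun v => by
      convert! hδ.trans (G.minDegree_le_degree v)
  rw [hcard] at hkn hdeg
  have ht' : (1 : ℝ) ≤ t := by exact_mod_cast ht
  have hn' : 5 * (t : ℝ) + 2 ≤ n := by exact_mod_cast hn
  have htk' : (t : ℝ) ≤ k := by exact_mod_cast htk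
  have hkn' : 2 * (k : ℝ) + 2 ≤ n := by exact_mod_cast hkn
  obtain ⟨μ, hμ, hroot⟩ := exists_root_cliqueJoinCliqueUnionIsolated (n := n) ht' (by linarith)
  have h1 := le_adjSpectralRadius_cliqueJoinCliqueUnionIsolated ht (by omega)
    (show μ ≠ 0 by intro h; linarith) (by intro h; linarith) hroot
  have h2 := cliqueJoinCliqueUnionIsolated_poly_nonneg ht' htk' (by linarith) hn' hμ hroot
  have h3 := adjSpectralRadius_lt_of_degree_bounds hconn hGC hcard (ht.trans htk) hkn hHL hH hL
    hLdeg hdeg (by linarith) h2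
  linarith

end SimpleGraph

theorem theorem1p8 {V : Type*} [Fintype V] (G : SimpleGraph V) [DecidableRel G.Adj]
    (n t : ℕ) (hcard : Fintype.card V = n) (ht : 1 ≤ t) (hn : 5 * t + 2 ≤ n)
    (hconn : G.Connected) (hδ : t ≤ G.minDegree)
    (hspec : (SimpleGraph.cliqueJoinCliqueUnionIsolated n t).adjSpectralRadius
      ≤ G.adjSpectralRadius) :
    ∃ T : SimpleGraph V, T ≤ G ∧ T.IsTree ∧ 4 ≤ T.leafDistance := by
  have := hconn.nonempty
  obtain ⟨T, hTG, hT, hd⟩ :=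
    (hconn.traceable_of_le_adjSpectralRadius hcard ht hn hδ hspec).exists_isTree_leafDistance
  refine ⟨T, hTG, hT, le_trans ?_ hd⟩
  exact_mod_cast (show 4 ≤ Fintype.card V - 1 by omega)
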